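/- Let $0<p\le\infty$. For $n\ge 2$ let $\Delta_p^n$ be the part of the unit sphere of $\ell_p^n$ in $[0,\infty)^n$, that is, $\Delta_p^n=\{t\in[0,\infty)^n:\sum_{j=1}^n t_j^p=1\}$ if $p<\infty$ and $\Delta_\infty^n=\{t\in[0,\infty)^n:\max_j t_j=1\}$. Let $\mu_p$ be the normalized cone measure on $\Delta_p^n$, that is, $\mu_p(A)=\lambda([0,1]\cdot A)/\lambda([0,1]\cdot\Delta_p^n)$ for Borel sets $A\subseteq\Delta_p^n$, where $\lambda$ is the Lebesgue measure on $\mathbb R^n$ and $[0,1]\cdot A=\{tx:t\in[0,1],\,x\in A\}$. For $x\in\mathbb R^n$ let $\sigma_m(x)_\infty=\inf\{\|x-y\|_\infty: y\in\mathbb R^n \text{ has at most } m \text{ non-zero coordinates}\}$, and let $$\sigma_m^{p,\infty}(\mu_p)=\int_{\Delta_p^n}\sigma_m(x)_\infty\,d\mu_p(x).$$ With the convention $1/\infty=0$, the following hold. (i) There is a constant $C_p>0$, depending only on $p$, such that for all integers $n\ge 2$ and $0\le m\le n-1$ $$\sigma_m^{p,\infty}(\mu_p)\le C_p\left[\frac{\log\left(\frac{en}{m+1}\right)}{n}\right]^{1/p}.$$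 (ii) There are constants $0<\varepsilon_p<1$ and $c_p>0$, depending only on $p$, such that for all integers $n\ge 2$ and $0\le m\le\varepsilon_p n$ $$\sigma_m^{p,\infty}(\mu_p)\ge c_p\left[\frac{\log\left(\frac{en}{m+1}\right)}{n}\right]^{1/p}.$$ -/

import Mathlib

open MeasureTheory Set
open scoped ENNReal Pointwise

noncomputable section

namespace ConeWidth

/-- The set `Σ_m` of `m`-sparse vectors of `ℝⁿ`. -/
def sparse (n m : ℕ) : Set (Fin n → ℝ) :=
  {y | (Function.support y).ncard ≤ m}

/-- The error `σ_m(x)_q` of the best `m`-term approximation of `x ∈ ℝⁿ` in `ℓ_q^n`. Here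
`‖WithLp.toLp q z‖` is `(∑ |z_j|^q)^(1/q)` for `0 < q < ∞` and `max |z_j|` for `q = ∞`. -/
def bestApprox {n : ℕ} (m : ℕ) (q : ℝ≥0∞) (x : Fin n → ℝ) : ℝ :=
  ⨅ y : sparse n m, ‖WithLp.toLp q (x - (y : Fin n → ℝ))‖

/-- The part `Δ_p^n` of the unit sphere of `ℓ_p^n` in the orthant `[0, ∞)^n`. -/
def posSphere (p : ℝ≥0∞) (n : ℕ) : Set (Fin n → ℝ) :=
  {t | (∀ j, 0 ≤ t j) ∧ if p = ∞ then ⨆ j, t j = 1 else ∑ j, t j ^ p.toReal = 1}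

/-- The average surface best `m`-term width `σ_m^{p,q}(μ)`. -/
def avgWidth {p : ℝ≥0∞} {n : ℕ} (m : ℕ) (q : ℝ≥0∞) (μ : Measure (posSphere p n)) : ℝ :=
  ∫ x, bestApprox m q (x : Fin n → ℝ) ∂μ

/-- The cone `[0, 1] · A = {t x : t ∈ [0, 1], x ∈ A}` over a subset `A` of `Δ_p^n`. -/
def cone {p : ℝ≥0∞} {n : ℕ} (A : Set (posSphere p n)) : Set (Fin n → ℝ) :=
  Icc (0 : ℝ) 1 • ((↑) '' A : Set (Fin n → ℝ))

theorem measurableSet_posSphere (p : ℝ≥0∞) (n : ℕ) : MeasurableSet (posSphere p n) := by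
  have h0 : MeasurableSet {t : Fin n → ℝ | ∀ j, 0 ≤ t j} := by
    rw [Set.ofPred_forall]
    exact MeasurableSet.iInter fun j =>
      measurableSet_le measurable_const (measurable_pi_apply j)
  by_cases hp : p = ∞
  · have h1 : MeasurableSet {t : Fin n → ℝ | ⨆ j, t j = 1} :=
      measurableSet_eq_fun (Measurable.iSup fun j => measurable_pi_apply j) measurable_const
    have : posSphere p n = {t | ∀ j, 0 ≤ t j} ∩ {t | ⨆ j, t j = 1} := by
      ext t; simp [posSphere, hp]
    rw [this]; exact h0.inter h1
  · have h1 : MeasurableSet {t : Fin n → ℝ | ∑ j, t j ^ p.toReal = 1} :=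
      measurableSet_eq_fun
        (Finset.measurable_sum _ fun j _ => (measurable_pi_apply j).pow_const _)
        measurable_const
    have : posSphere p n = {t | ∀ j, 0 ≤ t j} ∩ {t | ∑ j, t j ^ p.toReal = 1} := by
      ext t; simp [posSphere, hp]
    rw [this]; exact h0.inter h1

theorem eq_of_smul_eq {p : ℝ≥0∞} (hp : 0 < p) {n : ℕ} {r s : ℝ} (hr : 0 < r) (hs : 0 < s)
    {x y : Fin n → ℝ} (hx : x ∈ posSphere p n) (hy : y ∈ posSphere p n)
    (h : r • x = s • y) : r = s ∧ x = y := by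
  have hrs : r = s := by
    obtain ⟨hx0, hx1⟩ := hx
    obtain ⟨hy0, hy1⟩ := hy
    by_cases hpt : p = ∞
    · simp only [hpt, if_true] at hx1 hy1
      have e : ⨆ j, (r • x) j = ⨆ j, (s • y) j := by rw [h]
      simp only [Pi.smul_apply, smul_eq_mul] at e
      rwa [← Real.mul_iSup_of_nonneg hr.le, ← Real.mul_iSup_of_nonneg hs.le, hx1, hy1,
        mul_one, mul_one] at e
    · simp only [hpt, if_false] at hx1 hy1
      have hp' : p.toReal ≠ 0 := (ENNReal.toReal_pos hp.ne' hpt).ne'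
      have key : ∀ (a : ℝ) (z : Fin n → ℝ), 0 < a → (∀ j, 0 ≤ z j) →
          ∑ j, z j ^ p.toReal = 1 → ∑ j, (a • z) j ^ p.toReal = a ^ p.toReal := by
        intro a z ha hz hz1
        simp only [Pi.smul_apply, smul_eq_mul]
        rw [Finset.sum_congr rfl fun j _ => Real.mul_rpow ha.le (hz j), ← Finset.mul_sum, hz1,
          mul_one]
      have e := key r x hr hx0 hx1
      rw [h, key s y hs hy0 hy1] at e
      exact ((Real.rpow_left_inj hs.le hr.le hp').1 e).symm
  subst hrs
  exact ⟨rfl, smul_right_injective _ hr.ne' h⟩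

theorem isEmpty_posSphere_zero (p : ℝ≥0∞) : IsEmpty (posSphere p 0) := by
  refine ⟨fun t => ?_⟩
  have h := t.2.2
  by_cases hp : p = ∞ <;> simp [hp] at h

theorem nullMeasurableSet_cone {p : ℝ≥0∞} (hp : 0 < p) {n : ℕ} [NeZero n]
    {A : Set (posSphere p n)} (hA : MeasurableSet A) : NullMeasurableSet (cone A) volume := by
  set B : Set (Fin n → ℝ) := (↑) '' A with hB
  have hBm : MeasurableSet B := (measurableSet_posSphere p n).subtype_image hA
  have hBs : B ⊆ posSphere p n := by rintro _ ⟨x, _, rfl⟩; exact x.2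
  have h1 : MeasurableSet ((fun z : ℝ × (Fin n → ℝ) => z.1 • z.2) '' (Ioc (0 : ℝ) 1 ×ˢ B)) := by
    refine (measurableSet_Ioc.prod hBm).image_of_continuousOn_injOn
      (continuous_fst.smul continuous_snd).continuousOn ?_
    rintro ⟨r, x⟩ ⟨hr, hx⟩ ⟨s, y⟩ ⟨hs, hy⟩ h
    obtain ⟨h1, h2⟩ := eq_of_smul_eq hp hr.1 hs.1 (hBs hx) (hBs hy) h
    exact Prod.ext h1 h2
  refine h1.nullMeasurableSet.congr ?_
  have h0 : ∀ᵐ z : Fin n → ℝ, z ≠ 0 := by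
    simp [ae_iff]
  filter_upwards [h0] with z hz
  refine propext ⟨?_, ?_⟩
  · rintro ⟨⟨r, x⟩, ⟨hr, hx⟩, rfl⟩
    exact smul_mem_smul ⟨hr.1.le, hr.2⟩ hx
  · rintro ⟨r, hr, x, hx, rfl⟩
    refine ⟨(r, x), ⟨⟨lt_of_le_of_ne hr.1 ?_, hr.2⟩, hx⟩, rfl⟩
    rintro rfl
    exact hz (zero_smul _ _)

theorem volume_cone_iUnion {p : ℝ≥0∞} (hp : 0 < p) (n : ℕ) (A : ℕ → Set (posSphere p n))
    (hA : ∀ i, MeasurableSet (A i)) (hd : Pairwise (Function.onFun Disjoint A)) :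
    volume (cone (⋃ i, A i)) = ∑' i, volume (cone (A i)) := by
  rcases Nat.eq_zero_or_pos n with rfl | hn
  · have := isEmpty_posSphere_zero p
    have : ∀ B : Set (posSphere p 0), cone B = ∅ := fun B => by
      rw [Set.eq_empty_of_isEmpty B]; simp [cone]
    simp [this]
  have : NeZero n := ⟨hn.ne'⟩
  have hU : cone (⋃ i, A i) = ⋃ i, cone (A i) := by
    simp only [cone, image_iUnion, smul_iUnion]
  rw [hU]
  refine measure_iUnion₀ (fun i j hij => ?_) fun i => nullMeasurableSet_cone hp (hA i)
  refine measure_mono_null (t := {0}) ?_ (by simp)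
  rintro z ⟨⟨r, hr, _, ⟨x, hx, rfl⟩, hz⟩, ⟨s, hs, _, ⟨y, hy, rfl⟩, hz'⟩⟩
  simp only at hz hz'
  by_contra hne
  have hz0 : z ≠ 0 := hne
  have hr0 : 0 < r := lt_of_le_of_ne hr.1 (by rintro rfl; exact hz0 (by rw [← hz, zero_smul]))
  have hs0 : 0 < s := lt_of_le_of_ne hs.1 (by rintro rfl; exact hz0 (by rw [← hz', zero_smul]))
  have hxy := (eq_of_smul_eq hp hr0 hs0 x.2 y.2 (hz.trans hz'.symm)).2
  have : x = y := Subtype.ext hxy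
  subst this
  exact Set.disjoint_left.1 (hd hij) hx hy

/-- The normalized cone measure on `Δ_p^n`: the measure with
`μ_p(A) = λ([0, 1] · A) / λ([0, 1] · Δ_p^n)` for every Borel set `A ⊆ Δ_p^n`, where `λ` is the
Lebesgue measure. -/
def coneMeasure (p : ℝ≥0∞) (hp : 0 < p) (n : ℕ) : Measure (posSphere p n) :=
  Measure.ofMeasurable
    (fun A _ => volume (cone A) / volume (cone (univ : Set (posSphere p n))))
    (by simp [cone])
    (fun A hA hd => by
      simp only [div_eq_mul_inv]
      rw [ENNReal.tsum_mul_right, volume_cone_iUnion hp n A hA hd])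

end ConeWidth

end

namespace ConeWidth

/-! For a nonnegative vector with `m < n`, the best `m`-term error in the sup norm is its (m+1)-th
largest coordinate, so the theorem is about an order statistic. The cone measure is the law of
X/‖X‖_p, where X has i.i.d. coordinates: with density proportional to exp(-t^a), a = p, when p is
finite, and uniform on (0, 1] when p = ∞. This works because the joint density depends only on ‖X‖_p
and Lebesgue measure is homogeneous (`coneMeasure_eq_map_pi_expPow`, `coneMeasure_top_eq_map`).

Order statistics are never computed. The error is compared pointwise with sums and products of
one-coordinate functions, whose expectations are explicit by independence. Write G = ∑ X_j^a and L =
log(en/(m+1)).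

Upper bound (`bestApprox_direction_le`): if G < δn, the error is at most 1 ≤ exp(δn - G), whose mean
is exponentially small. Otherwise more than m coordinates satisfy X_j^a ≥ Gβ^a, where β is the
error, so (m+1) exp(Gβ^a/2) ≤ ∑ exp(X_j^a/2). The right side has mean of order n, which makes β^a of
order L/n.

Lower bound (`le_bestApprox_direction`): β is at least s/(Kn)^(1/a) unless G > Kn or at most m
coordinates reach s. Markov's inequality controls the first event, an exponential Chernoff weight
the second, and s^a proportional to L is affordable since the tail at s is at least of order
exp(-2^a s^a).

For p = ∞ both bounds are constants. -/

/-! ### The sup-norm error as an order statistic. -/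

theorem bestApprox_top_eq_infDist {n : ℕ} (m : ℕ) (x : Fin n → ℝ) :
    bestApprox m ∞ x = Metric.infDist x (sparse n m) := by
  rw [Metric.infDist_eq_iInf]
  simp only [bestApprox, dist_eq_norm, PiLp.norm_toLp]

theorem continuous_bestApprox_top {n : ℕ} (m : ℕ) :
    Continuous (bestApprox (n := n) m ∞) := by
  rw [funext (bestApprox_top_eq_infDist (n := n) m)]
  exact Metric.continuous_infDist_pt _

theorem bestApprox_top_nonneg {n : ℕ} (m : ℕ) (x : Fin n → ℝ) : 0 ≤ bestApprox m ∞ x := by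
  rw [bestApprox_top_eq_infDist]
  exact Metric.infDist_nonneg

theorem sparse_nonempty (n m : ℕ) : (sparse n m).Nonempty := by
  refine ⟨0, ?_⟩
  simp [sparse]

/-- By pigeonhole an `m`-sparse vector vanishes somewhere on `T`, where it misses `x` by at least
`s`. -/
theorem le_bestApprox_top {n m : ℕ} {s : ℝ} {x : Fin n → ℝ} (T : Finset (Fin n))
    (hT : m < T.card) (h : ∀ j ∈ T, s ≤ x j) : s ≤ bestApprox m ∞ x := by
  rw [bestApprox_top_eq_infDist, Metric.le_infDist (sparse_nonempty n m)]
  intro y hy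
  obtain ⟨j, hj, hy0⟩ : ∃ j ∈ T, y j = 0 := by
    by_contra! hc
    have h1 : (T : Set (Fin n)) ⊆ Function.support y := fun j hj => hc j hj
    have h2 := Set.ncard_le_ncard h1 (Set.toFinite _)
    rw [Set.ncard_coe_finset] at h2
    exact absurd (h2.trans hy) (not_le.2 hT)
  calc s ≤ x j := h j hj
    _ ≤ |x j - y j| := by rw [hy0, sub_zero]; exact le_abs_self _
    _ ≤ dist x y := by rw [← Real.dist_eq]; exact dist_le_pi_dist x y j

/-- If at most `m` coordinates reached the error, keeping exactly those would give a sparse vector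
strictly closer to `x` than the error allows. The hypothesis `m < n` leaves a coordinate outside the
kept set, which makes the error positive. -/
theorem lt_card_filter_bestApprox_top_le {n m : ℕ} (hm : m < n) {x : Fin n → ℝ}
    (hx : ∀ j, 0 ≤ x j) :
    m < (Finset.univ.filter fun j => bestApprox m ∞ x ≤ x j).card := by
  set T := Finset.univ.filter fun j => bestApprox m ∞ x ≤ x j with hT
  by_contra! hc
  obtain ⟨i, hi⟩ : ∃ i, i ∉ T := by
    by_contra! h
    have : T = Finset.univ := Finset.eq_univ_iff_forall.2 h
    rw [this, Finset.card_univ, Fintype.card_fin] at hc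
    omega
  have hlt : ∀ j ∉ T, x j < bestApprox m ∞ x := fun j hj => by
    simpa [hT] using hj
  have hpos : 0 < bestApprox m ∞ x := (hx i).trans_lt (hlt i hi)
  let y : Fin n → ℝ := fun j => if j ∈ T then x j else 0
  have hy : y ∈ sparse n m := by
    refine le_trans ?_ hc
    rw [← Set.ncard_coe_finset]
    refine Set.ncard_le_ncard (fun j hj => ?_) (Set.toFinite _)
    by_contra h
    exact hj (if_neg h)
  have h1 : bestApprox m ∞ x ≤ dist x y := by
    rw [bestApprox_top_eq_infDist]
    exact Metric.infDist_le_dist_of_mem hy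
  refine absurd h1 (not_le.2 ((dist_pi_lt_iff hpos).2 fun j => ?_))
  by_cases hj : j ∈ T
  · simpa [y, hj] using hpos
  · simpa [y, hj, Real.dist_eq, abs_of_nonneg (hx j)] using hlt j hj

theorem posSphere_le_one {p : ℝ≥0∞} (hp : 0 < p) {n : ℕ} {x : Fin n → ℝ}
    (hx : x ∈ posSphere p n) (j : Fin n) : x j ≤ 1 := by
  obtain ⟨h0, h1⟩ := hx
  by_cases hpt : p = ∞
  · simp only [hpt, if_true] at h1
    rw [← h1]
    exact le_ciSup (f := x) (Set.finite_range _).bddAbove j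
  · simp only [hpt, if_false] at h1
    have h2 : x j ^ p.toReal ≤ 1 := by
      rw [← h1]
      exact Finset.single_le_sum (f := fun j => x j ^ p.toReal)
        (fun i _ => Real.rpow_nonneg (h0 i) _) (Finset.mem_univ j)
    have hp' : 0 < p.toReal := ENNReal.toReal_pos hp.ne' hpt
    by_contra! h
    exact absurd h2 (not_le.2 (Real.one_lt_rpow h hp'))

theorem bestApprox_top_le_one {p : ℝ≥0∞} (hp : 0 < p) {n m : ℕ} (hm : m < n) {x : Fin n → ℝ}
    (hx : x ∈ posSphere p n) : bestApprox m ∞ x ≤ 1 := by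
  obtain ⟨j, hj⟩ := Finset.card_pos.1
    ((Nat.zero_le m).trans_lt (lt_card_filter_bestApprox_top_le hm hx.1))
  exact (Finset.mem_filter.1 hj).2.trans (posSphere_le_one hp hx j)

/-! ### Radial projection and the cone measure as a pushforward. -/

/-- The `ℓ_p` quasi-norm of a vector with nonnegative coordinates. -/
noncomputable def orthantNorm (p : ℝ≥0∞) {n : ℕ} (x : Fin n → ℝ) : ℝ :=
  if p = ∞ then ⨆ j, x j else (∑ j, x j ^ p.toReal) ^ (p.toReal)⁻¹

theorem measurable_orthantNorm (p : ℝ≥0∞) (n : ℕ) :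
    Measurable (orthantNorm p : (Fin n → ℝ) → ℝ) := by
  unfold orthantNorm
  split_ifs
  · exact Measurable.iSup fun j => measurable_pi_apply j
  · exact (Finset.measurable_sum _ fun j _ => (measurable_pi_apply j).pow_const _).pow_const _

theorem orthantNorm_smul {p : ℝ≥0∞} (hp : 0 < p) {n : ℕ} {r : ℝ} (hr : 0 ≤ r) {x : Fin n → ℝ}
    (hx : ∀ j, 0 ≤ x j) : orthantNorm p (r • x) = r * orthantNorm p x := by
  unfold orthantNorm
  split_ifs with h
  · simp only [Pi.smul_apply, smul_eq_mul]
    rw [Real.mul_iSup_of_nonneg hr]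
  · have hp' : p.toReal ≠ 0 := (ENNReal.toReal_pos hp.ne' h).ne'
    simp only [Pi.smul_apply, smul_eq_mul]
    rw [Finset.sum_congr rfl fun j _ => Real.mul_rpow hr (hx j), ← Finset.mul_sum,
      Real.mul_rpow (Real.rpow_nonneg hr _)
        (Finset.sum_nonneg fun j _ => Real.rpow_nonneg (hx j) _), Real.rpow_rpow_inv hr hp']

theorem orthantNorm_pos (p : ℝ≥0∞) {n : ℕ} [NeZero n] {x : Fin n → ℝ}
    (hx : ∀ j, 0 < x j) : 0 < orthantNorm p x := by
  unfold orthantNorm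
  split_ifs with h
  · exact (hx 0).trans_le (le_ciSup (f := x) (Set.finite_range _).bddAbove 0)
  · exact Real.rpow_pos_of_pos
      (Finset.sum_pos (fun j _ => Real.rpow_pos_of_pos (hx j) _) Finset.univ_nonempty) _

theorem orthantNorm_eq_one_of_mem {p : ℝ≥0∞} {n : ℕ} {x : Fin n → ℝ}
    (hx : x ∈ posSphere p n) : orthantNorm p x = 1 := by
  obtain ⟨-, h1⟩ := hx
  unfold orthantNorm
  split_ifs with h
  · simpa [h] using h1
  · simp only [h, if_false] at h1
    rw [h1, Real.one_rpow]

theorem mem_posSphere_of_orthantNorm_eq_one {p : ℝ≥0∞} (hp : 0 < p) {n : ℕ} {x : Fin n → ℝ}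
    (hx : ∀ j, 0 ≤ x j) (h1 : orthantNorm p x = 1) : x ∈ posSphere p n := by
  refine ⟨hx, ?_⟩
  unfold orthantNorm at h1
  split_ifs with h
  · simpa [h] using h1
  · have hp' : p.toReal ≠ 0 := (ENNReal.toReal_pos hp.ne' h).ne'
    simp only [h, if_false] at h1
    rw [← Real.rpow_inv_rpow (x := ∑ j, x j ^ p.toReal)
      (Finset.sum_nonneg fun j _ => Real.rpow_nonneg (hx j) _) hp', h1, Real.one_rpow]

theorem smul_mem_posSphere {p : ℝ≥0∞} (hp : 0 < p) {n : ℕ} [NeZero n] {x : Fin n → ℝ}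
    (hx : ∀ j, 0 < x j) : (orthantNorm p x)⁻¹ • x ∈ posSphere p n := by
  have h0 := orthantNorm_pos p hx
  refine mem_posSphere_of_orthantNorm_eq_one hp (fun j => ?_) ?_
  · exact mul_nonneg (inv_nonneg.2 h0.le) (hx j).le
  · rw [orthantNorm_smul hp (inv_nonneg.2 h0.le) fun j => (hx j).le, inv_mul_cancel₀ h0.ne']

theorem single_mem_posSphere {p : ℝ≥0∞} (hp : 0 < p) (n : ℕ) [NeZero n] :
    (Pi.single 0 1 : Fin n → ℝ) ∈ posSphere p n := by
  have hs : ∀ j, (Pi.single 0 1 : Fin n → ℝ) j = if j = 0 then 1 else 0 := fun j => by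
    rw [Pi.single_apply]
  refine ⟨fun j => ?_, ?_⟩
  · rw [hs]; split_ifs <;> norm_num
  · split_ifs with h
    · refine le_antisymm (ciSup_le fun j => ?_) ?_
      · rw [hs]; split_ifs <;> norm_num
      · have := le_ciSup (f := (Pi.single 0 1 : Fin n → ℝ)) (Set.finite_range _).bddAbove 0
        simpa using this
    · have hp' : p.toReal ≠ 0 := (ENNReal.toReal_pos hp.ne' h).ne'
      simp only [hs, ite_pow, Real.one_rpow]
      rw [Finset.sum_eq_single 0]
      · simp
      · intro j _ hj; simp [hj, hp']
      · simp

open Classical in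
/-- The radial projection `x ↦ x / ‖x‖_p` onto `Δ_p^n`, with an arbitrary value where this is
not in `Δ_p^n`. -/
noncomputable def direction {p : ℝ≥0∞} (hp : 0 < p) {n : ℕ} [NeZero n] (x : Fin n → ℝ) :
    posSphere p n :=
  ⟨if (orthantNorm p x)⁻¹ • x ∈ posSphere p n then (orthantNorm p x)⁻¹ • x else Pi.single 0 1, by
    split_ifs with h
    · exact h
    · exact single_mem_posSphere hp n⟩

theorem coe_direction {p : ℝ≥0∞} (hp : 0 < p) {n : ℕ} [NeZero n] {x : Fin n → ℝ}
    (hx : ∀ j, 0 < x j) : (direction hp x : Fin n → ℝ) = (orthantNorm p x)⁻¹ • x :=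
  if_pos (smul_mem_posSphere hp hx)

theorem measurable_direction {p : ℝ≥0∞} (hp : 0 < p) (n : ℕ) [NeZero n] :
    Measurable (direction hp : (Fin n → ℝ) → posSphere p n) := by
  have h : Measurable fun x : Fin n → ℝ => (orthantNorm p x)⁻¹ • x :=
    (measurable_orthantNorm p n).inv.smul measurable_id
  exact (Measurable.ite (h (measurableSet_posSphere p n)) h measurable_const).subtype_mk

/-- The part of the truncated cone `[0, r] · A` inside the open orthant. -/
def openCone {p : ℝ≥0∞} (hp : 0 < p) {n : ℕ} [NeZero n] (A : Set (posSphere p n)) (r : ℝ) :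
    Set (Fin n → ℝ) :=
  {x | (∀ j, 0 < x j) ∧ orthantNorm p x ≤ r ∧ direction hp x ∈ A}

theorem direction_smul {p : ℝ≥0∞} (hp : 0 < p) {n : ℕ} [NeZero n] {x : Fin n → ℝ}
    (hx : ∀ j, 0 < x j) {r : ℝ} (hr : 0 < r) : direction hp (r • x) = direction hp x := by
  apply Subtype.ext
  rw [coe_direction hp hx, coe_direction hp (x := r • x) fun j => mul_pos hr (hx j),
    orthantNorm_smul hp hr.le fun j => (hx j).le, smul_smul]
  congr 1
  field_simp

/-- The two sets differ only on coordinate hyperplanes, which are null; off them `direction` is the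
true radial projection. -/
theorem volume_cone_eq {p : ℝ≥0∞} (hp : 0 < p) {n : ℕ} [NeZero n] (A : Set (posSphere p n)) :
    volume (cone A) = volume (openCone hp A 1) := by
  refine measure_congr ?_
  have h0 : ∀ᵐ x : Fin n → ℝ, ∀ j, x j ≠ 0 :=
    ae_all_iff.2 fun j => Measure.ae_eval_ne (μ := fun _ : Fin n => (volume : Measure ℝ)) j 0
  filter_upwards [h0] with x hx
  refine propext ⟨?_, ?_⟩
  · rintro ⟨r, hr, _, ⟨y, hy, rfl⟩, rfl⟩
    have hr0 : r ≠ 0 := by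
      rintro rfl
      exact hx 0 (by simp)
    have hr1 : 0 < r := lt_of_le_of_ne hr.1 hr0.symm
    have hpos : ∀ j, 0 < (y : Fin n → ℝ) j := fun j =>
      lt_of_le_of_ne (y.2.1 j) fun h => hx j (by simp [← h])
    refine ⟨fun j => mul_pos hr1 (hpos j), ?_, ?_⟩
    · simp only
      rw [orthantNorm_smul hp hr.1 y.2.1, orthantNorm_eq_one_of_mem y.2, mul_one]
      exact hr.2
    · simp only
      rw [direction_smul hp hpos hr1]
      convert hy
      apply Subtype.ext
      rw [coe_direction hp hpos, orthantNorm_eq_one_of_mem y.2, inv_one, one_smul]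
  · rintro ⟨hpos, h1, hA⟩
    have h := orthantNorm_pos p hpos
    refine ⟨orthantNorm p x, ⟨h.le, h1⟩, _, ⟨_, hA, rfl⟩, ?_⟩
    simp only
    rw [coe_direction hp hpos, smul_smul, mul_inv_cancel₀ h.ne', one_smul]

theorem volume_openCone {p : ℝ≥0∞} (hp : 0 < p) {n : ℕ} [NeZero n] (A : Set (posSphere p n))
    {r : ℝ} (hr : 0 < r) :
    volume (openCone hp A r) = ENNReal.ofReal (r ^ n) * volume (cone A) := by
  have h : openCone hp A r = r • openCone hp A 1 := by
    ext x
    rw [mem_smul_set_iff_inv_smul_mem₀ hr.ne']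
    have hi : 0 < r⁻¹ := inv_pos.2 hr
    have hiff : (∀ j, 0 < (r⁻¹ • x) j) ↔ ∀ j, 0 < x j :=
      forall_congr' fun j => by simp [mul_pos_iff_of_pos_left, hi]
    simp only [openCone, mem_ofPred_eq, hiff]
    refine and_congr_right fun hx => ?_
    rw [direction_smul hp hx hi, orthantNorm_smul hp hi.le fun j => (hx j).le,
      inv_mul_le_iff₀ hr, mul_one]
  rw [h, Measure.addHaar_smul, volume_cone_eq hp]
  simp [abs_of_pos hr]

theorem coneMeasure_apply {p : ℝ≥0∞} (hp : 0 < p) {n : ℕ} {A : Set (posSphere p n)}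
    (hA : MeasurableSet A) :
    coneMeasure p hp n A = volume (cone A) / volume (cone (univ : Set (posSphere p n))) :=
  Measure.ofMeasurable_apply A hA

/-- Proportionality to the cone volume suffices: taking `A = univ` forces `c` to be the inverse of
the total cone volume. -/
theorem coneMeasure_eq_map {p : ℝ≥0∞} (hp : 0 < p) {n : ℕ} [NeZero n]
    (P : Measure (Fin n → ℝ)) [IsProbabilityMeasure P] (c : ℝ≥0∞)
    (h : ∀ A : Set (posSphere p n), MeasurableSet A →
      P (direction hp ⁻¹' A) = c * volume (cone A)) :
    coneMeasure p hp n = P.map (direction hp) := by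
  have h1 : c * volume (cone (univ : Set (posSphere p n))) = 1 := by
    rw [← h _ MeasurableSet.univ, preimage_univ, measure_univ]
  ext A hA
  rw [coneMeasure_apply hp hA, Measure.map_apply (measurable_direction hp n) hA, h A hA,
    ENNReal.eq_inv_of_mul_eq_one_left h1, mul_comm, div_eq_mul_inv]

theorem avgWidth_eq_integral {p : ℝ≥0∞} (hp : 0 < p) {n m : ℕ} [NeZero n]
    {P : Measure (Fin n → ℝ)} (h : coneMeasure p hp n = P.map (direction hp)) :
    avgWidth m ∞ (coneMeasure p hp n) =
      ∫ x, bestApprox m ∞ (direction hp x : Fin n → ℝ) ∂P := by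
  rw [avgWidth, h]
  exact integral_map (measurable_direction hp n).aemeasurable
    ((continuous_bestApprox_top m).comp continuous_subtype_val).aestronglyMeasurable

theorem integrable_bestApprox_direction {p : ℝ≥0∞} (hp : 0 < p) {n m : ℕ} [NeZero n]
    (hm : m < n) (P : Measure (Fin n → ℝ)) [IsProbabilityMeasure P] :
    Integrable (fun x => bestApprox m ∞ (direction hp x : Fin n → ℝ)) P := by
  refine Integrable.mono' (integrable_const 1) ?_ (ae_of_all _ fun x => ?_)
  · exact (((continuous_bestApprox_top m).comp continuous_subtype_val).measurable.comp
      (measurable_direction hp n)).aestronglyMeasurable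
  · rw [Real.norm_of_nonneg (bestApprox_top_nonneg _ _)]
    exact bestApprox_top_le_one hp hm (direction hp x).2

/-! ### Product laws whose directions follow the cone measure. -/

theorem pi_withDensity_ofReal {ι : Type*} [Fintype ι] {f : ℝ → ℝ} (hf : Integrable f)
    (hf0 : ∀ t, 0 ≤ f t) :
    Measure.pi (fun _ : ι => volume.withDensity fun t => ENNReal.ofReal (f t)) =
      (volume : Measure (ι → ℝ)).withDensity fun x => ENNReal.ofReal (∏ j, f (x j)) := by
  have := isFiniteMeasure_withDensity_ofReal hf.2
  refine Measure.pi_eq fun s hs => ?_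
  have hi : ∀ j, Integrable ((s j).indicator f) := fun j => hf.indicator (hs j)
  have hi0 : ∀ j t, 0 ≤ (s j).indicator f t := fun j t => indicator_nonneg (fun t _ => hf0 t) t
  have hbox : MeasurableSet (univ.pi s) := MeasurableSet.univ_pi hs
  rw [withDensity_apply _ hbox, ← lintegral_indicator hbox]
  have h1 : ∀ x : ι → ℝ, (univ.pi s).indicator (fun x => ENNReal.ofReal (∏ j, f (x j))) x =
      ENNReal.ofReal (∏ j, (s j).indicator f (x j)) := by
    intro x
    by_cases hx : x ∈ univ.pi s
    · rw [indicator_of_mem hx]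
      congr 1
      exact Finset.prod_congr rfl fun j _ => (indicator_of_mem (hx j (mem_univ j)) f).symm
    · rw [indicator_of_notMem hx]
      obtain ⟨j, hj⟩ : ∃ j, x j ∉ s j := by simpa using hx
      rw [Finset.prod_eq_zero (Finset.mem_univ j) (indicator_of_notMem hj f), ENNReal.ofReal_zero]
  simp_rw [h1]
  have hint : Integrable (fun x : ι → ℝ => ∏ j, (s j).indicator f (x j)) := by
    rw [volume_pi]
    exact Integrable.fintype_prod hi
  rw [← ofReal_integral_eq_lintegral_ofReal hint
    (ae_of_all _ fun x => Finset.prod_nonneg fun j _ => hi0 j (x j)),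
    integral_fintype_prod_volume_eq_prod (fun j => (s j).indicator f),
    ENNReal.ofReal_prod_of_nonneg fun j _ => integral_nonneg (hi0 j)]
  refine Finset.prod_congr rfl fun j _ => ?_
  rw [ofReal_integral_eq_lintegral_ofReal (hi j) (ae_of_all _ (hi0 j)),
    withDensity_apply _ (hs j), ← lintegral_indicator (hs j)]
  congr 1
  ext t
  by_cases ht : t ∈ s j <;> simp [ht]

/-- The probability density proportional to `exp (-t ^ a)` on `(0, ∞)`. -/
noncomputable def expPowDensity (a : ℝ) (t : ℝ) : ℝ :=
  (Ioi (0 : ℝ)).indicator (fun t => (Real.Gamma (1 / a + 1))⁻¹ * Real.exp (-t ^ a)) t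

/-- The probability measure with density proportional to `exp (-t ^ a)` on `(0, ∞)`. -/
noncomputable def expPow (a : ℝ) : Measure ℝ :=
  volume.withDensity fun t => ENNReal.ofReal (expPowDensity a t)

theorem Gamma_one_div_add_one_pos {a : ℝ} (ha : 0 < a) : 0 < Real.Gamma (1 / a + 1) :=
  Real.Gamma_pos_of_pos (by positivity)

theorem expPowDensity_nonneg {a : ℝ} (ha : 0 < a) (t : ℝ) : 0 ≤ expPowDensity a t :=
  indicator_nonneg (fun _ _ => mul_nonneg (inv_nonneg.2 (Gamma_one_div_add_one_pos ha).le)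
    (Real.exp_pos _).le) t

theorem measurable_expPowDensity (a : ℝ) : Measurable (expPowDensity a) :=
  (Measurable.const_mul (Real.measurable_exp.comp (measurable_id.pow_const a).neg) _).indicator
    measurableSet_Ioi

theorem integrableOn_exp_neg_rpow {a : ℝ} (ha : 0 < a) :
    IntegrableOn (fun t : ℝ => Real.exp (-t ^ a)) (Ioi 0) := by
  have := integrableOn_rpow_mul_exp_neg_rpow (p := a) (s := 0) (by norm_num) ha
  simpa using this

theorem integrable_expPowDensity {a : ℝ} (ha : 0 < a) : Integrable (expPowDensity a) :=
  (integrable_indicator_iff measurableSet_Ioi).2 ((integrableOn_exp_neg_rpow ha).const_mul _)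

theorem integral_expPowDensity {a : ℝ} (ha : 0 < a) : ∫ t, expPowDensity a t = 1 := by
  unfold expPowDensity
  rw [integral_indicator measurableSet_Ioi, integral_const_mul, integral_exp_neg_rpow ha,
    inv_mul_cancel₀ (Gamma_one_div_add_one_pos ha).ne']

theorem isProbabilityMeasure_expPow {a : ℝ} (ha : 0 < a) : IsProbabilityMeasure (expPow a) := by
  constructor
  rw [expPow, withDensity_apply _ MeasurableSet.univ, Measure.restrict_univ,
    ← ofReal_integral_eq_lintegral_ofReal (integrable_expPowDensity ha)
      (ae_of_all _ (expPowDensity_nonneg ha)), integral_expPowDensity ha, ENNReal.ofReal_one]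

theorem integral_expPow {a : ℝ} (ha : 0 < a) (g : ℝ → ℝ) :
    ∫ t, g t ∂(expPow a) =
      (Real.Gamma (1 / a + 1))⁻¹ * ∫ t in Ioi 0, g t * Real.exp (-t ^ a) := by
  rw [expPow, integral_withDensity_eq_integral_toReal_smul
    (measurable_expPowDensity a).ennreal_ofReal (ae_of_all _ fun _ => ENNReal.ofReal_lt_top),
    ← integral_const_mul, ← integral_indicator measurableSet_Ioi]
  congr 1
  ext t
  rw [ENNReal.toReal_ofReal (expPowDensity_nonneg ha t), expPowDensity]
  by_cases ht : t ∈ Ioi (0 : ℝ)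
  · simp only [indicator_of_mem ht, smul_eq_mul]; ring
  · simp only [indicator_of_notMem ht, zero_smul]

theorem integrable_expPow {a : ℝ} (ha : 0 < a) {g : ℝ → ℝ}
    (hg : IntegrableOn (fun t => g t * Real.exp (-t ^ a)) (Ioi 0)) :
    Integrable g (expPow a) := by
  rw [expPow, integrable_withDensity_iff_integrable_smul'
    (measurable_expPowDensity a).ennreal_ofReal (ae_of_all _ fun _ => ENNReal.ofReal_lt_top)]
  have h := (integrable_indicator_iff measurableSet_Ioi).2
    (hg.const_mul (Real.Gamma (1 / a + 1))⁻¹)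
  refine h.congr (ae_of_all _ fun t => ?_)
  simp only
  rw [ENNReal.toReal_ofReal (expPowDensity_nonneg ha t), expPowDensity]
  by_cases ht : t ∈ Ioi (0 : ℝ)
  · simp only [indicator_of_mem ht, smul_eq_mul]; ring
  · simp only [indicator_of_notMem ht, zero_smul]

theorem ae_expPow_pos (a : ℝ) : ∀ᵐ t ∂(expPow a), 0 < t := by
  have hm : MeasurableSet {t : ℝ | ¬ 0 < t} :=
    (measurableSet_lt measurable_const measurable_id).compl
  rw [ae_iff, expPow, withDensity_apply _ hm, setLIntegral_congr_fun (g := fun _ => 0) hm]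
  · simp
  · intro t ht
    have ht' : t ∉ Ioi (0 : ℝ) := ht
    simp [expPowDensity, ht']

/-- The layer-cake formula replaces polar coordinates: on the open orthant the superlevel sets of
exp(-‖x‖_p^a) are truncated cones, and each contributes its radius to the power `n` times the volume
of `cone A`. -/
theorem exists_pi_expPow_preimage_direction {p : ℝ≥0∞} (hp : 0 < p) (hpt : p ≠ ∞) {n : ℕ}
    [NeZero n] : ∃ c : ℝ≥0∞, ∀ A : Set (posSphere p n), MeasurableSet A →
      Measure.pi (fun _ : Fin n => expPow p.toReal) (direction hp ⁻¹' A) =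
        c * volume (cone A) := by
  have ha : 0 < p.toReal := ENNReal.toReal_pos hp.ne' hpt
  set a := p.toReal with ha_def
  set Z := Real.Gamma (1 / a + 1) with hZ
  have hZ0 : 0 < Z := Gamma_one_div_add_one_pos ha
  -- The superlevel set at height t < 1 has radius (-log t)^(1/a); for t ≥ 1 it misses the open
  -- orthant.
  let g : ℝ → ℝ≥0∞ := fun t =>
    (Iio (1 : ℝ)).indicator (fun t => ENNReal.ofReal (((-Real.log t) ^ a⁻¹) ^ n)) t
  have hg : Measurable g := by
    refine Measurable.indicator ?_ measurableSet_Iio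
    exact ((Real.measurable_log.neg.pow_const _).pow_const _).ennreal_ofReal
  refine ⟨ENNReal.ofReal ((Z⁻¹) ^ n) * ∫⁻ t in Ioi 0, g t, fun A hA => ?_⟩
  have hO : MeasurableSet {x : Fin n → ℝ | ∀ j, 0 < x j} := by
    rw [Set.ofPred_forall]
    exact MeasurableSet.iInter fun j => measurableSet_lt measurable_const (measurable_pi_apply j)
  have hD : MeasurableSet (direction hp ⁻¹' A : Set (Fin n → ℝ)) := measurable_direction hp n hA
  set G : (Fin n → ℝ) → ℝ := fun x => Real.exp (-∑ j, x j ^ a) with hG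
  have hGm : Measurable G := Real.measurable_exp.comp
    (Finset.measurable_sum _ fun j _ => (measurable_pi_apply j).pow_const _).neg
  have h1 : ∀ x : Fin n → ℝ, ENNReal.ofReal (∏ j, expPowDensity a (x j)) =
      {x : Fin n → ℝ | ∀ j, 0 < x j}.indicator
        (fun x => ENNReal.ofReal ((Z⁻¹) ^ n) * ENNReal.ofReal (G x)) x := by
    intro x
    by_cases hx : x ∈ {x : Fin n → ℝ | ∀ j, 0 < x j}
    · rw [indicator_of_mem hx, ← ENNReal.ofReal_mul (by positivity)]
      congr 1
      have : ∀ j, expPowDensity a (x j) = Z⁻¹ * Real.exp (-x j ^ a) := fun j =>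
        indicator_of_mem (s := Ioi (0 : ℝ)) (hx j) _
      simp_rw [this, Finset.prod_mul_distrib, Finset.prod_const, Finset.card_univ,
        Fintype.card_fin, ← Real.exp_sum, Finset.sum_neg_distrib, hG]
    · rw [indicator_of_notMem hx]
      obtain ⟨j, hj⟩ : ∃ j, ¬ 0 < x j := by simpa using hx
      rw [Finset.prod_eq_zero (Finset.mem_univ j), ENNReal.ofReal_zero]
      exact indicator_of_notMem (s := Ioi (0 : ℝ)) hj _
  unfold expPow
  rw [pi_withDensity_ofReal (integrable_expPowDensity ha) (expPowDensity_nonneg ha),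
    withDensity_apply _ hD]
  rw [lintegral_congr h1, lintegral_indicator hO, Measure.restrict_restrict hO, lintegral_const_mul _
    hGm.ennreal_ofReal, mul_assoc]
  congr 1
  rw [lintegral_eq_lintegral_meas_le _ (ae_of_all _ fun x => (Real.exp_pos _).le)
    hGm.aemeasurable, ← lintegral_mul_const _ hg]
  refine setLIntegral_congr_fun measurableSet_Ioi fun t ht => ?_
  have ht0 : 0 < t := ht
  rw [Measure.restrict_apply (measurableSet_le measurable_const hGm)]
  by_cases ht1 : t < 1
  · have hl : 0 < -Real.log t := neg_pos.2 (Real.log_neg ht0 ht1)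
    have hr : 0 < (-Real.log t) ^ a⁻¹ := Real.rpow_pos_of_pos hl _
    have : g t = ENNReal.ofReal (((-Real.log t) ^ a⁻¹) ^ n) := indicator_of_mem (s := Iio 1) ht1 _
    rw [this, ← volume_openCone hp A hr]
    congr 1
    ext x
    simp only [openCone, mem_inter_iff, mem_ofPred_eq, mem_preimage, hG]
    have hiff : (∀ j, 0 < x j) → (t ≤ Real.exp (-∑ j, x j ^ a) ↔
        orthantNorm p x ≤ (-Real.log t) ^ a⁻¹) := by
      intro hx
      have hs : 0 ≤ ∑ j, x j ^ a := Finset.sum_nonneg fun j _ => Real.rpow_nonneg (hx j).le _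
      rw [orthantNorm, if_neg hpt, Real.rpow_le_rpow_iff hs hl.le (inv_pos.2 ha),
        ← Real.log_le_iff_le_exp ht0, le_neg]
    tauto
  · have : g t = 0 := indicator_of_notMem (s := Iio 1) ht1 _
    rw [this, zero_mul]
    refine measure_mono_null (t := ∅) (fun x hx => ?_) measure_empty
    obtain ⟨hx1, hx2, -⟩ := hx
    have hs : 0 < ∑ j, x j ^ a :=
      Finset.sum_pos (fun j _ => Real.rpow_pos_of_pos (hx2 j) _) Finset.univ_nonempty
    have : G x < 1 := Real.exp_lt_one_iff.2 (neg_lt_zero.2 hs)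
    exact absurd (lt_of_le_of_lt hx1 this) ht1

theorem coneMeasure_eq_map_pi_expPow {p : ℝ≥0∞} (hp : 0 < p) (hpt : p ≠ ∞) {n : ℕ} [NeZero n] :
    coneMeasure p hp n =
      (Measure.pi fun _ : Fin n => expPow p.toReal).map (direction hp) := by
  have := isProbabilityMeasure_expPow (ENNReal.toReal_pos hp.ne' hpt)
  obtain ⟨c, hc⟩ := exists_pi_expPow_preimage_direction hp hpt (n := n)
  exact coneMeasure_eq_map hp _ c hc

theorem pi_restrict_Ioc_eq {n : ℕ} :
    Measure.pi (fun _ : Fin n => (volume : Measure ℝ).restrict (Ioc 0 1)) =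
      (volume : Measure (Fin n → ℝ)).restrict (univ.pi fun _ => Ioc 0 1) :=
  (Measure.restrict_pi_pi _ _).symm

theorem isProbabilityMeasure_restrict_Ioc :
    IsProbabilityMeasure ((volume : Measure ℝ).restrict (Ioc 0 1)) :=
  ⟨by simp⟩

/-- In the positive orthant the unit ball of the sup norm is the cube itself, so the constant is 1.
-/
theorem coneMeasure_top_eq_map (hp : 0 < (∞ : ℝ≥0∞)) {n : ℕ} [NeZero n] :
    coneMeasure ∞ hp n =
      (Measure.pi fun _ : Fin n => (volume : Measure ℝ).restrict (Ioc 0 1)).map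
        (direction hp) := by
  have := isProbabilityMeasure_restrict_Ioc
  refine coneMeasure_eq_map hp _ 1 fun A hA => ?_
  rw [pi_restrict_Ioc_eq, Measure.restrict_apply (measurable_direction hp n hA), one_mul,
    volume_cone_eq hp]
  congr 1
  ext x
  have hle : orthantNorm ∞ x ≤ 1 ↔ ∀ j, x j ≤ 1 := by
    rw [orthantNorm, if_pos rfl]
    exact ciSup_le_iff (Set.finite_range _).bddAbove
  simp only [openCone, mem_inter_iff, mem_preimage, mem_pi, mem_univ, true_imp_iff, mem_Ioc,
    forall_and, mem_ofPred_eq, hle]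
  tauto

/-! ### Moments of the one-coordinate law. -/

theorem integrableOn_exp_neg_mul_rpow {a b : ℝ} (ha : 0 < a) (hb : 0 < b) :
    IntegrableOn (fun t : ℝ => Real.exp (-b * t ^ a)) (Ioi 0) := by
  have := integrableOn_rpow_mul_exp_neg_mul_rpow (p := a) (s := 0) (by norm_num) ha hb
  simpa using this

theorem integrable_exp_mul_rpow_expPow {a b : ℝ} (ha : 0 < a) (hb : b < 1) :
    Integrable (fun t : ℝ => Real.exp (b * t ^ a)) (expPow a) := by
  refine integrable_expPow ha ?_
  refine (integrableOn_exp_neg_mul_rpow ha (sub_pos.2 hb)).congr_fun (fun t _ => ?_)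
    measurableSet_Ioi
  simp only
  rw [← Real.exp_add]
  congr 1
  ring

theorem integral_exp_mul_rpow_expPow {a b : ℝ} (ha : 0 < a) (hb : b < 1) :
    ∫ t, Real.exp (b * t ^ a) ∂(expPow a) = (1 - b) ^ (-1 / a) := by
  have h : ∀ t : ℝ, Real.exp (b * t ^ a) * Real.exp (-t ^ a) = Real.exp (-(1 - b) * t ^ a) := by
    intro t
    rw [← Real.exp_add]
    congr 1
    ring
  have hZ := (Gamma_one_div_add_one_pos ha).ne'
  rw [integral_expPow ha]
  simp_rw [h]
  rw [integral_exp_neg_mul_rpow ha (sub_pos.2 hb)]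
  field_simp

theorem integrable_rpow_expPow {a : ℝ} (ha : 0 < a) :
    Integrable (fun t : ℝ => t ^ a) (expPow a) :=
  integrable_expPow ha (integrableOn_rpow_mul_exp_neg_rpow (by linarith) ha)

theorem integral_rpow_expPow {a : ℝ} (ha : 0 < a) :
    ∫ t, t ^ a ∂(expPow a) = 1 / a := by
  have hZ := (Gamma_one_div_add_one_pos ha).ne'
  rw [integral_expPow ha, integral_rpow_mul_exp_neg_rpow ha (by linarith), add_div, div_self ha.ne',
    add_comm 1 (1 / a)]
  field_simp

/-! ### Upper bound for finite p. -/

/-- Converts exponential control of w = Gβ^a/(2L) into control of w^(1/a), with a constant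
independent of `L`. For w ≥ 1 the power is absorbed by exp w, and w - 1 ≤ (w - 1)L. -/
theorem rpow_le_mul_one_add_exp {c w L : ℝ} (hc : 0 < c) (hw : 0 ≤ w) (hL : 1 ≤ L) :
    w ^ c ≤ (1 + c ^ c * Real.exp 1) * (1 + Real.exp ((w - 1) * L)) := by
  have h0 : 0 ≤ c ^ c * Real.exp 1 := by positivity
  have hE := Real.exp_pos ((w - 1) * L)
  rcases le_total w 1 with h | h
  · have h1 : w ^ c ≤ 1 := Real.rpow_le_one hw h hc.le
    nlinarith
  · have h1 : w ≤ c * Real.exp (w / c) := by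
      have := Real.add_one_le_exp (w / c)
      calc w = c * (w / c) := by field_simp
        _ ≤ _ := mul_le_mul_of_nonneg_left (by linarith) hc.le
    have h2 : w ^ c ≤ c ^ c * Real.exp w := by
      calc w ^ c ≤ (c * Real.exp (w / c)) ^ c := Real.rpow_le_rpow hw h1 hc.le
        _ = c ^ c * Real.exp w := by
          rw [Real.mul_rpow hc.le (Real.exp_pos _).le, ← Real.exp_mul, div_mul_cancel₀ _ hc.ne']
    have h3 : Real.exp w ≤ Real.exp 1 * Real.exp ((w - 1) * L) := by
      rw [← Real.exp_add]
      exact Real.exp_le_exp.2 (by nlinarith)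
    have h4 : c ^ c * Real.exp w ≤ c ^ c * (Real.exp 1 * Real.exp ((w - 1) * L)) :=
      mul_le_mul_of_nonneg_left h3 (by positivity)
    nlinarith

theorem one_le_log_exp_mul_div {n m : ℕ} (hm : m < n) :
    1 ≤ Real.log (Real.exp 1 * n / (m + 1)) := by
  have hm' : (m : ℝ) + 1 ≤ n := by exact_mod_cast hm
  have hm0 : (0 : ℝ) < m + 1 := by positivity
  rw [Real.le_log_iff_exp_le (by have : (0 : ℝ) < n := by linarith
                                 positivity), le_div_iff₀ hm0]
  exact mul_le_mul_of_nonneg_left hm' (Real.exp_pos _).le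

/-- The first summand pays for small G, the second for G ≥ δn. The exponents -1 and 1/2 are both
below 1, so all terms are integrable for the exponential power law. -/
theorem bestApprox_direction_le {p : ℝ≥0∞} (hp : 0 < p) (hpt : p ≠ ∞) {n m : ℕ} [NeZero n]
    (hm : m < n) {δ : ℝ} (hδ : 0 < δ) {x : Fin n → ℝ} (hx : ∀ j, 0 < x j) :
    bestApprox m ∞ (direction hp x : Fin n → ℝ) ≤
      Real.exp (δ * n) * ∏ j, Real.exp (-1 * x j ^ p.toReal) +
        (2 * Real.log (Real.exp 1 * n / (m + 1)) / (δ * n)) ^ (1 / p.toReal) *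
          ((1 + (1 / p.toReal) ^ (1 / p.toReal) * Real.exp 1) *
            (1 + (1 / (Real.exp 1 * n)) * ∑ j, Real.exp (1 / 2 * x j ^ p.toReal))) := by
  have ha : 0 < p.toReal := ENNReal.toReal_pos hp.ne' hpt
  set a := p.toReal with ha_def
  set L := Real.log (Real.exp 1 * n / (m + 1)) with hL
  have hL1 : 1 ≤ L := one_le_log_exp_mul_div hm
  have hn : (0 : ℝ) < n := by exact_mod_cast (Nat.zero_le m).trans_lt hm
  have hm0 : (0 : ℝ) < m + 1 := by positivity
  set z : Fin n → ℝ := (direction hp x : Fin n → ℝ) with hz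
  have hz0 : ∀ j, 0 ≤ z j := (direction hp x).2.1
  set β := bestApprox m ∞ z with hβ
  have hβ0 : 0 ≤ β := bestApprox_top_nonneg m z
  set G := ∑ j, x j ^ a with hG
  have hG0 : 0 < G :=
    Finset.sum_pos (fun j _ => Real.rpow_pos_of_pos (hx j) _) Finset.univ_nonempty
  have hprod : ∏ j, Real.exp (-1 * x j ^ a) = Real.exp (-G) := by
    rw [← Real.exp_sum]; simp [hG]
  set E := ∑ j, Real.exp (1 / 2 * x j ^ a) with hE
  have hE0 : 0 ≤ E := Finset.sum_nonneg fun j _ => (Real.exp_pos _).le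
  rw [hprod, ← Real.exp_add]
  have hexp := Real.exp_pos (δ * n + -G)
  rcases lt_or_ge G (δ * n) with hlt | hge
  · have h1 : β ≤ 1 := bestApprox_top_le_one hp hm (direction hp x).2
    have h2 : 1 ≤ Real.exp (δ * n + -G) := Real.one_le_exp (by linarith)
    have h3 : 0 ≤ (2 * L / (δ * n)) ^ (1 / a) *
        ((1 + (1 / a) ^ (1 / a) * Real.exp 1) * (1 + (1 / (Real.exp 1 * n)) * E)) := by positivity
    linarith
  · have hcount := lt_card_filter_bestApprox_top_le hm hz0
    have hxz : ∀ j, G * z j ^ a = x j ^ a := by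
      intro j
      have hN : 0 < orthantNorm p x := orthantNorm_pos p hx
      have hNG : orthantNorm p x ^ a = G := by
        rw [orthantNorm, if_neg hpt, Real.rpow_inv_rpow hG0.le ha.ne']
      rw [hz, coe_direction hp hx, Pi.smul_apply, smul_eq_mul,
        Real.mul_rpow (inv_nonneg.2 hN.le) (hx j).le, Real.inv_rpow hN.le, hNG]
      field_simp
    have hsum : (m + 1) * Real.exp (1 / 2 * (G * β ^ a)) ≤ E := by
      set T := Finset.univ.filter fun j => bestApprox m ∞ z ≤ z j with hT
      calc (m + 1) * Real.exp (1 / 2 * (G * β ^ a))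
          ≤ T.card * Real.exp (1 / 2 * (G * β ^ a)) := by
            refine mul_le_mul_of_nonneg_right ?_ (Real.exp_pos _).le
            exact_mod_cast hcount
        _ = ∑ j ∈ T, Real.exp (1 / 2 * (G * β ^ a)) := by
            rw [Finset.sum_const, nsmul_eq_mul]
        _ ≤ ∑ j ∈ T, Real.exp (1 / 2 * x j ^ a) := by
            refine Finset.sum_le_sum fun j hj => Real.exp_le_exp.2 ?_
            rw [← hxz j]
            have : β ^ a ≤ z j ^ a :=
              Real.rpow_le_rpow hβ0 (Finset.mem_filter.1 hj).2 ha.le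
            have := mul_le_mul_of_nonneg_left this hG0.le
            linarith
        _ ≤ E := Finset.sum_le_sum_of_subset_of_nonneg (Finset.subset_univ T)
            fun j _ _ => (Real.exp_pos _).le
    -- Normalized so that exp((w - 1)L) = exp(Gβ^a/2)(m+1)/(en), which `hsum` bounds by E/(en), of
    -- bounded mean.
    set w := G * β ^ a / (2 * L) with hw
    have hw0 : 0 ≤ w := by positivity
    have hwL : Real.exp ((w - 1) * L) ≤ 1 / (Real.exp 1 * n) * E := by
      have h1 : (w - 1) * L = 1 / 2 * (G * β ^ a) - L := by
        rw [hw]; field_simp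
      have h2 : Real.exp L = Real.exp 1 * n / (m + 1) :=
        Real.exp_log (by positivity)
      rw [h1, Real.exp_sub, h2]
      calc Real.exp (1 / 2 * (G * β ^ a)) / (Real.exp 1 * n / (m + 1))
          = 1 / (Real.exp 1 * n) * ((m + 1) * Real.exp (1 / 2 * (G * β ^ a))) := by
            field_simp
        _ ≤ _ := mul_le_mul_of_nonneg_left hsum (by positivity)
    have hwC := rpow_le_mul_one_add_exp (one_div_pos.2 ha) hw0 hL1
    have hβw : β ≤ (2 * L / (δ * n)) ^ (1 / a) * w ^ (1 / a) := by
      rw [← Real.mul_rpow (by positivity) hw0]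
      have h1 : β ^ a ≤ 2 * L / (δ * n) * w := by
        have : 2 * L / (δ * n) * w = G / (δ * n) * β ^ a := by
          rw [hw]; field_simp
        rw [this]
        refine le_mul_of_one_le_left (Real.rpow_nonneg hβ0 _) ?_
        rwa [one_le_div (by positivity)]
      calc β = (β ^ a) ^ (1 / a) := by rw [one_div, Real.rpow_rpow_inv hβ0 ha.ne']
        _ ≤ _ := Real.rpow_le_rpow (Real.rpow_nonneg hβ0 _) h1 (by positivity)
    have hfin : w ^ (1 / a) ≤
        (1 + (1 / a) ^ (1 / a) * Real.exp 1) * (1 + (1 / (Real.exp 1 * n)) * E) := by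
      refine hwC.trans (mul_le_mul_of_nonneg_left ?_ (by positivity))
      linarith
    have := mul_le_mul_of_nonneg_left hfin
      (show 0 ≤ (2 * L / (δ * n)) ^ (1 / a) by positivity)
    linarith

theorem ae_pi_pos {n : ℕ} {ρ : Measure ℝ} [SigmaFinite ρ] (h : ∀ᵐ t ∂ρ, 0 < t) :
    ∀ᵐ x ∂(Measure.pi fun _ : Fin n => ρ), ∀ j, 0 < x j :=
  ae_all_iff.2 fun j =>
    (Measure.tendsto_eval_ae_ae (μ := fun _ : Fin n => ρ) (i := j)).eventually h

theorem integral_comp_eval_pi {n : ℕ} (ρ : Measure ℝ) [IsProbabilityMeasure ρ] (j : Fin n)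
    {f : ℝ → ℝ} (hf : AEStronglyMeasurable f ρ) :
    ∫ x, f (x j) ∂(Measure.pi fun _ : Fin n => ρ) = ∫ t, f t ∂ρ :=
  integral_comp_eval (μ := fun _ : Fin n => ρ) hf

theorem exp_neg_mul_log_two_le {n : ℕ} (hn : 0 < n) :
    Real.exp (-(n * (Real.log 2 / 2))) ≤ 4 / n := by
  have hn' : (0 : ℝ) < n := by exact_mod_cast hn
  rw [Real.exp_neg, inv_le_comm₀ (Real.exp_pos _) (by positivity), inv_div]
  have h1 := Real.add_one_le_exp (n * (Real.log 2 / 2))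
  have h2 := Real.log_two_gt_d9
  nlinarith

theorem exists_avgWidth_le {p : ℝ≥0∞} (hp : 0 < p) (hpt : p ≠ ∞) :
    ∃ C : ℝ, 0 < C ∧ ∀ n m : ℕ, m < n → avgWidth m ∞ (coneMeasure p hp n) ≤
      C * (Real.log (Real.exp 1 * n / (m + 1)) / n) ^ (1 / p.toReal) := by
  have ha : 0 < p.toReal := ENNReal.toReal_pos hp.ne' hpt
  set a := p.toReal with ha_def
  have := isProbabilityMeasure_expPow ha
  have hl2 := Real.log_pos one_lt_two
  -- Half of the rate log 2 / a at which the mean of exp(-G) decays, leaving the factor 2^(-n/(2a)).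
  set δ := Real.log 2 / (2 * a) with hδ_def
  have hδ : 0 < δ := by positivity
  set D := (1 + (1 / a) ^ (1 / a) * Real.exp 1) * (1 + 1 / Real.exp 1 * 2 ^ (1 / a)) with hD
  have hD0 : 0 < D := by positivity
  refine ⟨4 ^ (1 / a) + (2 / δ) ^ (1 / a) * D, by positivity, fun n m hm => ?_⟩
  have hn0 : 0 < n := (Nat.zero_le m).trans_lt hm
  have : NeZero n := ⟨hn0.ne'⟩
  have hn : (0 : ℝ) < n := by exact_mod_cast hn0
  have hL1 := one_le_log_exp_mul_div hm
  rw [avgWidth_eq_integral hp (coneMeasure_eq_map_pi_expPow hp hpt)]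
  set L := Real.log (Real.exp 1 * n / (m + 1)) with hL
  set P := Measure.pi fun _ : Fin n => expPow a with hP
  set B := (2 * L / (δ * n)) ^ (1 / a) with hB
  set D₁ := 1 + (1 / a) ^ (1 / a) * Real.exp 1 with hD₁
  have hi1 : Integrable (fun x : Fin n → ℝ => ∏ j, Real.exp (-1 * x j ^ a)) P :=
    Integrable.fintype_prod (f := fun _ t => Real.exp (-1 * t ^ a))
      fun _ => integrable_exp_mul_rpow_expPow ha (by norm_num)
  have hi2 : Integrable (fun x : Fin n → ℝ => ∑ j, Real.exp (1 / 2 * x j ^ a)) P :=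
    integrable_finsetSum _ fun j _ => integrable_comp_eval (μ := fun _ : Fin n => expPow a)
      (integrable_exp_mul_rpow_expPow ha (by norm_num))
  have hI1 : ∫ x : Fin n → ℝ, ∏ j, Real.exp (-1 * x j ^ a) ∂P = ((2 : ℝ) ^ (-1 / a)) ^ n := by
    rw [hP, integral_fintype_prod_eq_pow (fun t => Real.exp (-1 * t ^ a)),
      integral_exp_mul_rpow_expPow ha (by norm_num), Fintype.card_fin]
    norm_num
  have hI2 : ∫ x : Fin n → ℝ, ∑ j, Real.exp (1 / 2 * x j ^ a) ∂P = n * 2 ^ (1 / a) := by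
    rw [integral_finsetSum _ fun j _ => integrable_comp_eval (μ := fun _ : Fin n => expPow a)
      (f := fun t => Real.exp (1 / 2 * t ^ a))
      (integrable_exp_mul_rpow_expPow ha (by norm_num))]
    have : ∀ j : Fin n, ∫ x : Fin n → ℝ, Real.exp (1 / 2 * x j ^ a) ∂P = 2 ^ (1 / a) := by
      intro j
      rw [hP, integral_comp_eval_pi (expPow a) j (f := fun t => Real.exp (1 / 2 * t ^ a))
        (integrable_exp_mul_rpow_expPow ha (by norm_num)).aestronglyMeasurable,
        integral_exp_mul_rpow_expPow ha (by norm_num), show (1 - 1 / 2 : ℝ) = 2⁻¹ by norm_num,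
        Real.inv_rpow zero_le_two, ← Real.rpow_neg zero_le_two, neg_div, neg_neg]
    rw [Finset.sum_congr rfl fun j _ => this j]
    simp
  have hi3 : Integrable (fun x : Fin n → ℝ =>
      1 + 1 / (Real.exp 1 * n) * ∑ j, Real.exp (1 / 2 * x j ^ a)) P :=
    (integrable_const 1).add (hi2.const_mul _)
  have hstep : ∫ x, bestApprox m ∞ (direction hp x : Fin n → ℝ) ∂P ≤
      Real.exp (δ * n) * ((2 : ℝ) ^ (-1 / a)) ^ n + B * D := by
    have hint := (hi1.const_mul (Real.exp (δ * n))).add ((hi3.const_mul D₁).const_mul B)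
    refine (integral_mono_ae (integrable_bestApprox_direction hp hm P) hint ?_).trans
      (le_of_eq ?_)
    · filter_upwards [ae_pi_pos (ae_expPow_pos a)] with x hx
      exact bestApprox_direction_le hp hpt hm hδ hx
    · rw [integral_add' (hi1.const_mul _) ((hi3.const_mul D₁).const_mul B), integral_const_mul,
        integral_const_mul, integral_const_mul, integral_add (integrable_const _)
        (hi2.const_mul _), integral_const_mul, hI1, hI2, integral_const]
      simp only [probReal_univ, smul_eq_mul]
      rw [hD]
      field_simp
  refine hstep.trans ?_
  -- The exponentially small term is weakened to (4/n)^(1/a), and L ≥ 1.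
  have h1 : Real.exp (δ * n) * ((2 : ℝ) ^ (-1 / a)) ^ n ≤ 4 ^ (1 / a) * (L / n) ^ (1 / a) := by
    have : Real.exp (δ * n) * ((2 : ℝ) ^ (-1 / a)) ^ n =
        Real.exp (-(n * (Real.log 2 / 2))) ^ (1 / a) := by
      rw [Real.rpow_def_of_pos two_pos, ← Real.exp_nat_mul, ← Real.exp_add, ← Real.exp_mul]
      congr 1
      rw [hδ_def]
      field_simp
      ring
    rw [this, ← Real.mul_rpow (by norm_num) (by positivity)]
    refine Real.rpow_le_rpow (Real.exp_pos _).le ((exp_neg_mul_log_two_le hn0).trans ?_)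
      (by positivity)
    rw [mul_div_assoc']
    gcongr
    linarith
  have h2 : B = (2 / δ) ^ (1 / a) * (L / n) ^ (1 / a) := by
    rw [hB, ← Real.mul_rpow (by positivity) (by positivity)]
    congr 1
    field_simp
  rw [h2]
  linarith

/-! ### Lower bound for finite p. -/

/-- The function equal to `exp (-1)` on `[s, ∞)` and to `1` on `(-∞, s)`. -/
noncomputable def stepWeight (s t : ℝ) : ℝ := if s ≤ t then Real.exp (-1) else 1

theorem stepWeight_nonneg (s t : ℝ) : 0 ≤ stepWeight s t := by
  unfold stepWeight
  split_ifs
  · exact (Real.exp_pos _).le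
  · exact zero_le_one

theorem stepWeight_eq (s t : ℝ) :
    stepWeight s t = 1 - (Ici s).indicator (fun _ => 1 - Real.exp (-1)) t := by
  unfold stepWeight
  by_cases h : s ≤ t
  · rw [if_pos h, indicator_of_mem (s := Ici s) h]; ring
  · rw [if_neg h, indicator_of_notMem (s := Ici s) h]; ring

theorem integrable_stepWeight (s : ℝ) (ρ : Measure ℝ) [IsProbabilityMeasure ρ] :
    Integrable (stepWeight s) ρ := by
  rw [funext (stepWeight_eq s)]
  exact (integrable_const 1).sub ((integrable_const _).indicator measurableSet_Ici)

/-- With q the tail mass, the mean is 1 - (1 - 1/e)q ≤ 1 - q/2 ≤ exp(-q/2). -/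
theorem integral_stepWeight_le (s : ℝ) (ρ : Measure ℝ) [IsProbabilityMeasure ρ] :
    ∫ t, stepWeight s t ∂ρ ≤ Real.exp (-(ρ.real (Ici s) / 2)) := by
  simp_rw [stepWeight_eq]
  rw [integral_sub (integrable_const 1) ((integrable_const _).indicator measurableSet_Ici),
    integral_indicator_const _ measurableSet_Ici]
  simp only [integral_const, probReal_univ, smul_eq_mul, one_mul]
  have h1 := Real.add_one_le_exp (-(ρ.real (Ici s) / 2))
  have h2 : Real.exp (-1) ≤ 1 / 2 := by
    rw [Real.exp_neg, inv_le_comm₀ (Real.exp_pos _) (by norm_num)]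
    have := Real.add_one_le_exp (1 : ℝ)
    norm_num at this ⊢
    exact this
  have h3 : 0 ≤ ρ.real (Ici s) := measureReal_nonneg
  nlinarith

theorem integrable_prod_stepWeight {n : ℕ} (s : ℝ) (ρ : Measure ℝ) [IsProbabilityMeasure ρ] :
    Integrable (fun x : Fin n → ℝ => ∏ j, stepWeight s (x j)) (Measure.pi fun _ => ρ) :=
  Integrable.fintype_prod (f := fun _ => stepWeight s) fun _ => integrable_stepWeight s ρ

theorem integral_prod_stepWeight_le {n : ℕ} (s : ℝ) (ρ : Measure ℝ) [IsProbabilityMeasure ρ] :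
    ∫ x : Fin n → ℝ, ∏ j, stepWeight s (x j) ∂(Measure.pi fun _ => ρ) ≤
      Real.exp (-(n * ρ.real (Ici s) / 2)) := by
  rw [integral_fintype_prod_eq_pow (stepWeight s), Fintype.card_fin]
  calc (∫ t, stepWeight s t ∂ρ) ^ n ≤ Real.exp (-(ρ.real (Ici s) / 2)) ^ n :=
        pow_le_pow_left₀ (integral_nonneg (stepWeight_nonneg s)) (integral_stepWeight_le s ρ) n
    _ = _ := by
        rw [← Real.exp_nat_mul]
        congr 1
        ring

/-- The product is exp(-N), with N the number of coordinates reaching `s`. Thus exp(m - N) dominates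
the indicator of N ≤ m, as in Chernoff's bound. -/
theorem lt_card_filter_of_exp_mul_prod_stepWeight_lt_one {n m : ℕ} {s : ℝ} {x : Fin n → ℝ}
    (h : Real.exp m * ∏ j, stepWeight s (x j) < 1) :
    m < (Finset.univ.filter fun j => s ≤ x j).card := by
  by_contra! hc
  refine absurd h (not_lt.2 ?_)
  have : ∏ j, stepWeight s (x j) =
      Real.exp (-1) ^ (Finset.univ.filter fun j => s ≤ x j).card := by
    unfold stepWeight
    rw [Finset.prod_ite, Finset.prod_const, Finset.prod_const_one, mul_one]
  rw [this, ← Real.exp_nat_mul, ← Real.exp_add]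
  refine Real.one_le_exp ?_
  have : ((Finset.univ.filter fun j => s ≤ x j).card : ℝ) ≤ m := by exact_mod_cast hc
  linarith

/-- The bracket is at most 1, and it is positive only if G ≤ Kn and more than `m` coordinates reach
`s`; otherwise the bound is trivial. -/
theorem le_bestApprox_direction {p : ℝ≥0∞} (hp : 0 < p) (hpt : p ≠ ∞) {n m : ℕ} [NeZero n]
    {s K : ℝ} (hs : 0 ≤ s) (hK : 0 < K) {x : Fin n → ℝ} (hx : ∀ j, 0 < x j) :
    s / (K * n) ^ (1 / p.toReal) *
        (1 - (1 / (K * n)) * ∑ j, x j ^ p.toReal - Real.exp m * ∏ j, stepWeight s (x j)) ≤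
      bestApprox m ∞ (direction hp x : Fin n → ℝ) := by
  have ha : 0 < p.toReal := ENNReal.toReal_pos hp.ne' hpt
  set a := p.toReal with ha_def
  have hn : (0 : ℝ) < n := by exact_mod_cast Nat.pos_of_ne_zero (NeZero.ne n)
  set G := ∑ j, x j ^ a with hG
  have hG0 : 0 ≤ G := Finset.sum_nonneg fun j _ => Real.rpow_nonneg (hx j).le _
  have hW : 0 ≤ Real.exp m * ∏ j, stepWeight s (x j) :=
    mul_nonneg (Real.exp_pos _).le (Finset.prod_nonneg fun j _ => stepWeight_nonneg _ _)
  have hKn : 0 < K * n := mul_pos hK hn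
  have hM : 0 < (K * n) ^ (1 / a) := Real.rpow_pos_of_pos hKn _
  have hGK : 0 ≤ 1 / (K * n) * G := by positivity
  have hsM : 0 ≤ s / (K * n) ^ (1 / a) := by positivity
  rcases le_or_gt (1 - (1 / (K * n)) * G - Real.exp m * ∏ j, stepWeight s (x j)) 0 with h | h
  · exact (mul_nonpos_of_nonneg_of_nonpos hsM h).trans (bestApprox_top_nonneg _ _)
  · refine (mul_le_of_le_one_right hsM (by linarith)).trans ?_
    have hcount := lt_card_filter_of_exp_mul_prod_stepWeight_lt_one (m := m) (s := s) (x := x)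
      (by linarith)
    refine le_bestApprox_top _ hcount fun j hj => ?_
    have hN : 0 < orthantNorm p x := orthantNorm_pos p hx
    have hNM : orthantNorm p x ≤ (K * n) ^ (1 / a) := by
      rw [orthantNorm, if_neg hpt, one_div]
      refine Real.rpow_le_rpow hG0 ?_ (inv_nonneg.2 ha.le)
      have h1 : 1 / (K * n) * G ≤ 1 := by linarith
      rwa [one_div_mul_eq_div, div_le_one hKn] at h1
    rw [coe_direction hp hx, Pi.smul_apply, smul_eq_mul, inv_mul_eq_div]
    exact div_le_div₀ (hx j).le (Finset.mem_filter.1 hj).2 hN hNM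

/-- Only the mass of (s, s+1] is kept, with the density bounded below through (s+1)^a ≤ (2 max(s,
1))^a ≤ 2^a + 2^a s^a. -/
theorem exp_neg_le_expPow_Ici {a : ℝ} (ha : 0 < a) {s : ℝ} (hs : 0 ≤ s) :
    (Real.Gamma (1 / a + 1))⁻¹ * Real.exp (-2 ^ a) * Real.exp (-(2 ^ a * s ^ a)) ≤
      (expPow a).real (Ici s) := by
  have := isProbabilityMeasure_expPow ha
  have hZ : 0 < (Real.Gamma (1 / a + 1))⁻¹ := inv_pos.2 (Gamma_one_div_add_one_pos ha)
  have h1 : (s + 1) ^ a ≤ 2 ^ a + 2 ^ a * s ^ a := by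
    have h2a : (0 : ℝ) ≤ 2 ^ a := by positivity
    have hsa : 0 ≤ s ^ a := Real.rpow_nonneg hs _
    rcases le_total s 1 with h | h
    · calc (s + 1) ^ a ≤ 2 ^ a := Real.rpow_le_rpow (by linarith) (by linarith) ha.le
        _ ≤ _ := le_add_of_nonneg_right (by positivity)
    · calc (s + 1) ^ a ≤ (2 * s) ^ a := Real.rpow_le_rpow (by linarith) (by linarith) ha.le
        _ = 2 ^ a * s ^ a := Real.mul_rpow zero_le_two hs
        _ ≤ _ := le_add_of_nonneg_left h2a
  rw [mul_assoc, ← Real.exp_add]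
  have h2 : ENNReal.ofReal ((Real.Gamma (1 / a + 1))⁻¹ *
      Real.exp (-2 ^ a + -(2 ^ a * s ^ a))) ≤ expPow a (Ici s) := by
    calc ENNReal.ofReal ((Real.Gamma (1 / a + 1))⁻¹ * Real.exp (-2 ^ a + -(2 ^ a * s ^ a)))
        = ∫⁻ _ in Ioc s (s + 1), ENNReal.ofReal ((Real.Gamma (1 / a + 1))⁻¹ *
            Real.exp (-2 ^ a + -(2 ^ a * s ^ a))) := by simp
      _ ≤ ∫⁻ t in Ioc s (s + 1), ENNReal.ofReal (expPowDensity a t) := by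
          refine setLIntegral_mono' measurableSet_Ioc fun t ht => ENNReal.ofReal_le_ofReal ?_
          have ht0 : 0 < t := hs.trans_lt ht.1
          rw [expPowDensity, indicator_of_mem (s := Ioi (0 : ℝ)) ht0]
          refine mul_le_mul_of_nonneg_left (Real.exp_le_exp.2 ?_) hZ.le
          have := Real.rpow_le_rpow ht0.le ht.2 ha.le
          linarith
      _ = expPow a (Ioc s (s + 1)) := (withDensity_apply _ measurableSet_Ioc).symm
      _ ≤ expPow a (Ici s) := measure_mono fun t ht => ht.1.le
  exact (ENNReal.ofReal_le_iff_le_toReal (measure_ne_top _ _)).1 h2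

/-- Since G has mean n/a, K = 4/a makes the Markov term 1/4. The tail hypothesis makes the Chernoff
term at most exp(m - 2(m+1)) ≤ 1/4, which leaves 1/2. -/
theorem mul_le_avgWidth {p : ℝ≥0∞} (hp : 0 < p) (hpt : p ≠ ∞) {n m : ℕ} (hm : m < n)
    {s : ℝ} (hs : 0 ≤ s)
    (hq : 4 * ((m : ℝ) + 1) ≤ n * (expPow p.toReal).real (Ici s)) :
    s / (4 / p.toReal * n) ^ (1 / p.toReal) * (1 / 2) ≤
      avgWidth m ∞ (coneMeasure p hp n) := by
  have ha : 0 < p.toReal := ENNReal.toReal_pos hp.ne' hpt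
  have hn0 : 0 < n := (Nat.zero_le m).trans_lt hm
  have : NeZero n := ⟨hn0.ne'⟩
  have hn : (0 : ℝ) < n := by exact_mod_cast hn0
  have := isProbabilityMeasure_expPow ha
  rw [avgWidth_eq_integral hp (coneMeasure_eq_map_pi_expPow hp hpt)]
  set a := p.toReal with ha_def
  set P := Measure.pi fun _ : Fin n => expPow a with hP
  set M := s / (4 / a * n) ^ (1 / a) with hM
  have hM0 : 0 ≤ M := by positivity
  have hi1 : Integrable (fun x : Fin n → ℝ => ∑ j, x j ^ a) P :=
    integrable_finsetSum _ fun j _ => integrable_comp_eval (μ := fun _ : Fin n => expPow a)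
      (f := fun t => t ^ a) (integrable_rpow_expPow ha)
  have hI1 : ∫ x : Fin n → ℝ, ∑ j, x j ^ a ∂P = n / a := by
    rw [integral_finsetSum _ fun j _ => integrable_comp_eval (μ := fun _ : Fin n => expPow a)
      (f := fun t => t ^ a) (integrable_rpow_expPow ha)]
    have : ∀ j : Fin n, ∫ x : Fin n → ℝ, x j ^ a ∂P = 1 / a := fun j => by
      rw [hP, integral_comp_eval_pi (expPow a) j (f := fun t => t ^ a)
        (integrable_rpow_expPow ha).aestronglyMeasurable, integral_rpow_expPow ha]
    rw [Finset.sum_congr rfl fun j _ => this j]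
    simp [div_eq_mul_inv]
  have hi2 := integrable_prod_stepWeight (n := n) s (expPow a)
  have hI2 := integral_prod_stepWeight_le (n := n) s (expPow a)
  have hi3 : Integrable (fun x : Fin n → ℝ => 1 - 1 / (4 / a * n) * ∑ j, x j ^ a) P :=
    (integrable_const 1).sub (hi1.const_mul _)
  have hi4 : Integrable (fun x : Fin n → ℝ => 1 - 1 / (4 / a * n) * ∑ j, x j ^ a -
      Real.exp m * ∏ j, stepWeight s (x j)) P := hi3.sub (hi2.const_mul _)
  have hE : Real.exp m * ∫ x : Fin n → ℝ, ∏ j, stepWeight s (x j) ∂P ≤ 1 / 4 := by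
    calc Real.exp m * ∫ x : Fin n → ℝ, ∏ j, stepWeight s (x j) ∂P
        ≤ Real.exp m * Real.exp (-(n * (expPow a).real (Ici s) / 2)) :=
          mul_le_mul_of_nonneg_left hI2 (Real.exp_pos _).le
      _ ≤ Real.exp (-2) := by
          rw [← Real.exp_add]
          have : (0 : ℝ) ≤ m := Nat.cast_nonneg m
          exact Real.exp_le_exp.2 (by linarith)
      _ ≤ 1 / 4 := by
          have h1 := Real.add_one_le_exp (1 : ℝ)
          have h2 : Real.exp 2 = Real.exp 1 * Real.exp 1 := by rw [← Real.exp_add]; norm_num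
          rw [Real.exp_neg, one_div, inv_le_inv₀ (Real.exp_pos _) (by norm_num), h2]
          nlinarith
  calc M * (1 / 2) ≤ M * ∫ x : Fin n → ℝ, (1 - 1 / (4 / a * n) * ∑ j, x j ^ a -
        Real.exp m * ∏ j, stepWeight s (x j)) ∂P := by
        refine mul_le_mul_of_nonneg_left ?_ hM0
        rw [integral_sub hi3 (hi2.const_mul _), integral_sub (integrable_const _)
          (hi1.const_mul _), integral_const_mul, integral_const_mul, hI1, integral_const]
        simp only [probReal_univ, smul_eq_mul]
        have : 1 / (4 / a * n) * (n / a) = 1 / 4 := by field_simp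
        linarith
    _ = ∫ x : Fin n → ℝ, M * (1 - 1 / (4 / a * n) * ∑ j, x j ^ a -
        Real.exp m * ∏ j, stepWeight s (x j)) ∂P := (integral_const_mul _ _).symm
    _ ≤ _ := by
        refine integral_mono_ae (hi4.const_mul M) (integrable_bestApprox_direction hp hm P) ?_
        filter_upwards [ae_pi_pos (ae_expPow_pos a)] with x hx
        exact le_bestApprox_direction hp hpt hs (by positivity) hx

/-- Some coordinate has p-th power at least the average 1/n. This covers the bounded values of n
that the probabilistic estimate does not reach. -/
theorem inv_rpow_le_avgWidth_zero {p : ℝ≥0∞} (hp : 0 < p) (hpt : p ≠ ∞) {n : ℕ} (hn : 0 < n) :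
    (1 / (n : ℝ)) ^ (1 / p.toReal) ≤ avgWidth 0 ∞ (coneMeasure p hp n) := by
  have ha : 0 < p.toReal := ENNReal.toReal_pos hp.ne' hpt
  have : NeZero n := ⟨hn.ne'⟩
  have := isProbabilityMeasure_expPow ha
  rw [avgWidth_eq_integral hp (coneMeasure_eq_map_pi_expPow hp hpt)]
  set P := Measure.pi fun _ : Fin n => expPow p.toReal with hP
  have hc : ∫ _ : Fin n → ℝ, (1 / (n : ℝ)) ^ (1 / p.toReal) ∂P =
      (1 / (n : ℝ)) ^ (1 / p.toReal) := by simp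
  rw [← hc]
  refine integral_mono (integrable_const _) (integrable_bestApprox_direction hp hn P) fun x => ?_
  set z := direction hp x with hz
  have hz0 := z.2.1
  have hz1 : ∑ j, (z : Fin n → ℝ) j ^ p.toReal = 1 := by
    simpa [hpt] using z.2.2
  obtain ⟨j, -, hj⟩ : ∃ j ∈ Finset.univ, 1 / (n : ℝ) ≤ (z : Fin n → ℝ) j ^ p.toReal := by
    refine Finset.exists_le_of_sum_le Finset.univ_nonempty ?_
    rw [hz1]
    simp [NeZero.ne]
  refine le_bestApprox_top {j} (by simp) fun i hi => ?_
  rw [Finset.mem_singleton.1 hi]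
  calc (1 / (n : ℝ)) ^ (1 / p.toReal) ≤ ((z : Fin n → ℝ) j ^ p.toReal) ^ (1 / p.toReal) :=
        Real.rpow_le_rpow (by positivity) hj (by positivity)
    _ = _ := by rw [one_div, Real.rpow_rpow_inv (hz0 j) ha.ne']

theorem exists_le_avgWidth {p : ℝ≥0∞} (hp : 0 < p) (hpt : p ≠ ∞) :
    ∃ ε : ℝ, 0 < ε ∧ ε < 1 ∧ ∃ c : ℝ, 0 < c ∧ ∀ n m : ℕ, 0 < n → (m : ℝ) ≤ ε * n →
      c * (Real.log (Real.exp 1 * n / (m + 1)) / n) ^ (1 / p.toReal) ≤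
        avgWidth m ∞ (coneMeasure p hp n) := by
  have ha : 0 < p.toReal := ENNReal.toReal_pos hp.ne' hpt
  set a := p.toReal with ha_def
  set κ := (Real.Gamma (1 / a + 1))⁻¹ * Real.exp (-2 ^ a) with hκ
  have hκ0 : 0 < κ := mul_pos (inv_pos.2 (Gamma_one_div_add_one_pos ha)) (Real.exp_pos _)
  have he := Real.exp_pos 1
  -- Chosen so that n ≥ A(m+1) gives exp(L/2)κ ≥ 4e, the form of the tail condition needed below.
  set A := 1 + 16 * Real.exp 1 / κ ^ 2 with hA
  have hA1 : 1 ≤ A := by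
    rw [hA]; exact le_add_of_nonneg_right (by positivity)
  have hlA : 0 < Real.log (Real.exp 1 * A) := by
    refine Real.log_pos ?_
    have := Real.add_one_le_exp (1 : ℝ)
    nlinarith
  set c₁ := (1 / (2 * 2 ^ a * (4 / a))) ^ (1 / a) * (1 / 2) with hc₁
  set c₂ := (1 / Real.log (Real.exp 1 * A)) ^ (1 / a) with hc₂
  have hc₁0 : 0 < c₁ := by positivity
  have hc₂0 : 0 < c₂ := by positivity
  refine ⟨1 / (2 * A), by positivity, ?_, min c₁ c₂, lt_min hc₁0 hc₂0, fun n m hn0 hmn => ?_⟩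
  · rw [div_lt_one (by positivity)]; linarith
  have hn : (0 : ℝ) < n := by exact_mod_cast hn0
  have hm0 : (0 : ℝ) ≤ m := Nat.cast_nonneg m
  rcases le_or_gt (A * (m + 1)) n with h | h
  · have hm : m < n := by
      have : (m : ℝ) + 1 ≤ n := le_trans (le_mul_of_one_le_left (by positivity) hA1) h
      exact_mod_cast this
    have hL1 := one_le_log_exp_mul_div hm
    set L := Real.log (Real.exp 1 * n / (m + 1)) with hL
    -- This level has tail at least κ exp(-L/2), so n times the tail is at least of order √(n(m+1)),
    -- which beats 4(m+1) once n/(m+1) is large.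
    set s := (L / (2 * 2 ^ a)) ^ (1 / a) with hs
    have hs0 : 0 ≤ s := by positivity
    have hsa : s ^ a = L / (2 * 2 ^ a) := by
      rw [hs, one_div, Real.rpow_inv_rpow (by positivity) ha.ne']
    have hq := exp_neg_le_expPow_Ici ha hs0
    rw [hsa, ← hκ, show 2 ^ a * (L / (2 * 2 ^ a)) = L / 2 by field_simp] at hq
    have hq4 : 4 * ((m : ℝ) + 1) ≤ n * (expPow a).real (Ici s) := by
      refine le_trans ?_ (mul_le_mul_of_nonneg_left hq hn.le)
      set y := Real.exp (L / 2) with hy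
      have hy0 : 0 < y := Real.exp_pos _
      have hy2 : y * y = Real.exp 1 * n / (m + 1) := by
        rw [hy, ← Real.exp_add, add_halves, hL, Real.exp_log (by positivity)]
      have hyn : (n : ℝ) = (m + 1) * (y * y) / Real.exp 1 := by
        rw [hy2]; field_simp
      have hyκ : 4 * Real.exp 1 ≤ y * κ := by
        refine le_of_sq_le_sq ?_ (by positivity)
        have h1 : A ≤ n / (m + 1) := by rwa [le_div_iff₀ (by positivity)]
        have h2 : 16 * Real.exp 1 / κ ^ 2 ≤ n / (m + 1) := by linarith
        have h3 : Real.exp 1 * (16 * Real.exp 1 / κ ^ 2) ≤ y * y := by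
          rw [hy2, mul_div_assoc (Real.exp 1) (n : ℝ)]
          exact mul_le_mul_of_nonneg_left h2 he.le
        calc (4 * Real.exp 1) ^ 2 = Real.exp 1 * (16 * Real.exp 1 / κ ^ 2) * κ ^ 2 := by
              field_simp; ring
          _ ≤ y * y * κ ^ 2 := mul_le_mul_of_nonneg_right h3 (by positivity)
          _ = (y * κ) ^ 2 := by ring
      rw [Real.exp_neg, ← hy, hyn]
      calc 4 * ((m : ℝ) + 1) = (m + 1) * (4 * Real.exp 1) / Real.exp 1 := by field_simp
        _ ≤ (m + 1) * (y * κ) / Real.exp 1 := by gcongr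
        _ = _ := by field_simp
    refine le_trans ?_ (mul_le_avgWidth hp hpt hm hs0 hq4)
    refine (mul_le_mul_of_nonneg_right (min_le_left c₁ c₂) (by positivity)).trans (le_of_eq ?_)
    rw [← ha_def, hc₁, hs, ← Real.div_rpow (by positivity) (by positivity), mul_right_comm,
      ← Real.mul_rpow (by positivity) (by positivity)]
    congr 2
    field_simp
  -- Here n < A(m+1), while m ≤ n/(2A); hence m < (m+1)/2. What remains is m = 0 and n < A, where
  -- the logarithm is bounded.
  · have hm : m = 0 := by
      have h1 : 1 / (2 * A) * n < (m + 1) / 2 := by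
        rw [one_div_mul_eq_div, div_lt_div_iff₀ (by positivity) (by norm_num)]
        nlinarith
      have h2 : (m : ℝ) < 1 := by linarith
      have : m < 1 := by exact_mod_cast h2
      omega
    subst hm
    refine le_trans ?_ (inv_rpow_le_avgWidth_zero hp hpt hn0)
    have hL0 : 0 ≤ Real.log (Real.exp 1 * n / ((0 : ℕ) + 1)) :=
      zero_le_one.trans (one_le_log_exp_mul_div hn0)
    refine (mul_le_mul_of_nonneg_right (min_le_right c₁ c₂) (by positivity)).trans ?_
    rw [← ha_def, hc₂, ← Real.mul_rpow (by positivity) (by positivity)]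
    refine Real.rpow_le_rpow (by positivity) ?_ (by positivity)
    have hLA : Real.log (Real.exp 1 * n / ((0 : ℕ) + 1)) ≤ Real.log (Real.exp 1 * A) := by
      refine Real.log_le_log (by positivity) ?_
      simp only [Nat.cast_zero, zero_add, mul_one, div_one] at h ⊢
      exact mul_le_mul_of_nonneg_left h.le he.le
    calc 1 / Real.log (Real.exp 1 * A) * (Real.log (Real.exp 1 * n / ((0 : ℕ) + 1)) / n)
        ≤ 1 / Real.log (Real.exp 1 * A) * (Real.log (Real.exp 1 * A) / n) := by gcongr
      _ = 1 / n := by field_simp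

/-! ### The case p = ∞ and the conclusion. -/

theorem avgWidth_le_one {p : ℝ≥0∞} (hp : 0 < p) {n m : ℕ} [NeZero n] (hm : m < n)
    {P : Measure (Fin n → ℝ)} [IsProbabilityMeasure P]
    (h : coneMeasure p hp n = P.map (direction hp)) :
    avgWidth m ∞ (coneMeasure p hp n) ≤ 1 := by
  rw [avgWidth_eq_integral hp h]
  refine (integral_mono (integrable_bestApprox_direction hp hm P) (integrable_const 1)
    fun x => bestApprox_top_le_one hp hm (direction hp x).2).trans ?_
  simp

/-- About half of the uniform coordinates reach 1/2, and dividing by a norm at most 1 only enlarges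
them. The Chernoff term is at most exp(m - n/4) ≤ exp(-n/5) ≤ 5/6, and 1/12 = (1/2)(1 - 5/6). -/
theorem one_twelfth_le_avgWidth_top (hp : 0 < (∞ : ℝ≥0∞)) {n m : ℕ} (hn : 2 ≤ n)
    (hm : (m : ℝ) ≤ 1 / 20 * n) : 1 / 12 ≤ avgWidth m ∞ (coneMeasure ∞ hp n) := by
  have : NeZero n := ⟨by omega⟩
  have hn2 : (2 : ℝ) ≤ n := by exact_mod_cast hn
  have hmn : m < n := by
    have : (m : ℝ) < n := by linarith
    exact_mod_cast this
  set ρ : Measure ℝ := volume.restrict (Ioc 0 1) with hρ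
  have : IsProbabilityMeasure ρ := isProbabilityMeasure_restrict_Ioc
  rw [avgWidth_eq_integral hp (coneMeasure_top_eq_map hp)]
  set P := Measure.pi fun _ : Fin n => ρ with hP
  have hq : ρ.real (Ici (1 / 2)) = 1 / 2 := by
    have : Ici (1 / 2 : ℝ) ∩ Ioc 0 1 = Icc (1 / 2) 1 := by
      ext t
      simp only [mem_inter_iff, mem_Ici, mem_Ioc, mem_Icc]
      constructor
      · rintro ⟨h1, -, h2⟩; exact ⟨h1, h2⟩
      · rintro ⟨h1, h2⟩; exact ⟨h1, by linarith, h2⟩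
    rw [hρ, measureReal_restrict_apply measurableSet_Ici, this,
      Real.volume_real_Icc_of_le (by norm_num)]
    norm_num
  have hi := integrable_prod_stepWeight (n := n) (1 / 2) ρ
  have hI := integral_prod_stepWeight_le (n := n) (1 / 2) ρ
  rw [hq] at hI
  have hE : Real.exp m * ∫ x : Fin n → ℝ, ∏ j, stepWeight (1 / 2) (x j) ∂P ≤ 5 / 6 := by
    calc Real.exp m * ∫ x : Fin n → ℝ, ∏ j, stepWeight (1 / 2) (x j) ∂P
        ≤ Real.exp m * Real.exp (-(n * (1 / 2) / 2)) :=
          mul_le_mul_of_nonneg_left hI (Real.exp_pos _).le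
      _ ≤ Real.exp (-(1 / 5)) := by
          rw [← Real.exp_add]
          exact Real.exp_le_exp.2 (by linarith)
      _ ≤ 5 / 6 := by
          have h1 := Real.add_one_le_exp (1 / 5 : ℝ)
          rw [Real.exp_neg, inv_le_comm₀ (Real.exp_pos _) (by norm_num)]
          linarith
  have hi' : Integrable (fun x : Fin n → ℝ =>
      1 / 2 * (1 - Real.exp m * ∏ j, stepWeight (1 / 2) (x j))) P :=
    ((integrable_const 1).sub (hi.const_mul _)).const_mul _
  calc (1 / 12 : ℝ) ≤ ∫ x : Fin n → ℝ,
        1 / 2 * (1 - Real.exp m * ∏ j, stepWeight (1 / 2) (x j)) ∂P := by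
        rw [integral_const_mul, integral_sub (integrable_const _) (hi.const_mul _),
          integral_const_mul, integral_const]
        simp only [probReal_univ, smul_eq_mul]
        linarith
    _ ≤ _ := by
        refine integral_mono_ae hi' (integrable_bestApprox_direction hp hmn P) ?_
        have hpos : ∀ᵐ t ∂ρ, t ∈ Ioc (0 : ℝ) 1 := ae_restrict_mem measurableSet_Ioc
        have hae : ∀ᵐ x ∂P, ∀ j, x j ∈ Ioc (0 : ℝ) 1 := ae_all_iff.2 fun j =>
          (Measure.tendsto_eval_ae_ae (μ := fun _ : Fin n => ρ) (i := j)).eventually hpos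
        filter_upwards [hae] with x hx
        have hW : 0 ≤ Real.exp m * ∏ j, stepWeight (1 / 2) (x j) :=
          mul_nonneg (Real.exp_pos _).le (Finset.prod_nonneg fun j _ => stepWeight_nonneg _ _)
        rcases le_or_gt 1 (Real.exp m * ∏ j, stepWeight (1 / 2) (x j)) with h | h
        · exact le_trans (by linarith) (bestApprox_top_nonneg _ _)
        · refine le_trans (b := 1 / 2) (by linarith) ?_
          refine le_bestApprox_top _ (lt_card_filter_of_exp_mul_prod_stepWeight_lt_one h)
            fun j hj => ?_
          have hN := orthantNorm_pos ∞ fun j => (hx j).1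
          have hN1 : orthantNorm ∞ x ≤ 1 := by
            rw [orthantNorm, if_pos rfl]
            exact ciSup_le fun j => (hx j).2
          rw [coe_direction hp fun j => (hx j).1, Pi.smul_apply, smul_eq_mul]
          refine (Finset.mem_filter.1 hj).2.trans (le_mul_of_one_le_left (hx j).1.le ?_)
          exact (one_le_inv₀ hN).2 hN1

end ConeWidth

theorem theorem6 (p : ℝ≥0∞) (hp : 0 < p) :
    (∃ C : ℝ, 0 < C ∧ ∀ n m : ℕ, 2 ≤ n → m ≤ n - 1 →
      ConeWidth.avgWidth m ∞ (ConeWidth.coneMeasure p hp n) ≤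
        C * (Real.log (Real.exp 1 * n / (m + 1)) / n) ^ (1 / p).toReal) ∧
    (∃ ε : ℝ, 0 < ε ∧ ε < 1 ∧ ∃ c : ℝ, 0 < c ∧ ∀ n m : ℕ, 2 ≤ n → (m : ℝ) ≤ ε * n →
      c * (Real.log (Real.exp 1 * n / (m + 1)) / n) ^ (1 / p).toReal ≤
        ConeWidth.avgWidth m ∞ (ConeWidth.coneMeasure p hp n)) := by
  by_cases hpt : p = ∞
  · subst hpt
    -- The exponent 1/∞ = 0 turns the rate into 1, so constant bounds suffice.
    have hexp : (1 / ∞ : ℝ≥0∞).toReal = 0 := by simp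
    simp only [hexp, Real.rpow_zero, mul_one]
    refine ⟨⟨1, one_pos, fun n m hn hm => ?_⟩, 1 / 20, by norm_num, by norm_num, 1 / 12,
      by norm_num, fun n m hn hm => ConeWidth.one_twelfth_le_avgWidth_top hp hn hm⟩
    have : NeZero n := ⟨by omega⟩
    have := ConeWidth.isProbabilityMeasure_restrict_Ioc
    exact ConeWidth.avgWidth_le_one hp (by omega) (ConeWidth.coneMeasure_top_eq_map hp)
  · have hexp : (1 / p).toReal = 1 / p.toReal := by simp
    rw [hexp]
    obtain ⟨C, hC, hup⟩ := ConeWidth.exists_avgWidth_le hp hpt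
    obtain ⟨ε, hε, hε1, c, hc, hlow⟩ := ConeWidth.exists_le_avgWidth hp hpt
    exact ⟨⟨C, hC, fun n m hn hm => hup n m (by omega)⟩, ε, hε, hε1, c, hc,
      fun n m hn hm => hlow n m (by omega) hm⟩
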